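/- All spaces are $T_1$; zero-dimensional means $T_1$ with a base of clopen sets. For a property $P$ of subspaces, a space $X$ is $P$-bounded if every subspace of $X$ with property $P$ has compact closure in $X$; we use this for $\omega$ ("countable"), $\omega N$ ("countable and nowhere dense in the ambient space") and $C_2$ ("second countable"). For $Y\subseteq Z$, the $\omega N$-closure of $Y$ in $Z$ is $\mathrm{cl}^{\omega N}_Z(Y)=\bigcup\{\overline{A}^{Z} : A\subseteq Y,\ A \text{ countable and nowhere dense in } Z\}$. A space is nodec if each of its nowhere dense subsets is closed. Let $L$ be the one-point compactification, with point at infinity $y$, of $\omega_1\times 2^{\omega}$ (where $\omega_1$ carries the order topology), and for a space $X$ with compactification $cX$ let $M(X,cX)=\big[cX\times(L\setminus\{y\})\big]\cup\big(X\times\{y\}\big)$, a subspace of $cX\times L$. Then (in ZFC) the Cantor cube $2^{\mathfrak c}$ has a countable dense subspace that is nodec. Moreover, for every countable dense nodec subspace $S$ of $2^{\mathfrak c}$ and every $a\in S$, the subspace $X=\mathrm{cl}^{\omega N}_{2^{\mathfrak c}}(S\setminus\{a\})$ of $2^{\mathfrak c}$ is zero-dimensional, $\omega N$-bounded and $C_2$-bounded,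 but not $\omega$-bounded; $X$ is dense in $2^{\mathfrak c}$, so $2^{\mathfrak c}$ is a compactification of $X$; and the space $M(X,2^{\mathfrak c})$ is zero-dimensional and $C_2$-bounded but not $\omega N$-bounded. -/

import Mathlib

open Set TopologicalSpace

/-- Given a property `P` of subspaces of `X`, the space `X` is `P`-bounded iff every subspace
with property `P` has compact closure in `X`. -/
def PBounded (X : Type*) [TopologicalSpace X] (P : Set X → Prop) : Prop :=
  ∀ A : Set X, P A → IsCompact (closure A)

/-- The property `ωN`: countable and nowhere dense (in the ambient space). -/
def OmegaN {X : Type*} [TopologicalSpace X] (A : Set X) : Prop :=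
  A.Countable ∧ IsNowhereDense A

/-- The property `C₂`: second countable in the subspace topology. -/
def SecondCountableSubspace {X : Type*} [TopologicalSpace X] (A : Set X) : Prop :=
  SecondCountableTopology A

/-- `ω`-bounded: every countable set has compact closure. -/
def OmegaBounded (X : Type*) [TopologicalSpace X] : Prop :=
  PBounded X fun A => A.Countable

/-- `ωN`-bounded: every countable nowhere dense set has compact closure. -/
def OmegaNBounded (X : Type*) [TopologicalSpace X] : Prop :=
  PBounded X OmegaN

/-- `C₂`-bounded: every second countable subspace has compact closure. -/
def C2Bounded (X : Type*) [TopologicalSpace X] : Prop :=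
  PBounded X SecondCountableSubspace

/-- The `P`-closure of `Y` in `X`: the union of the closures (in `X`) of all subsets of `Y`
that have property `P` (as subspaces of `X`). -/
def pClosure {X : Type*} [TopologicalSpace X] (P : Set X → Prop) (Y : Set X) : Set X :=
  ⋃ A ∈ {A : Set X | A ⊆ Y ∧ P A}, closure A

/-- A space is nodec if all its nowhere dense subsets are closed. -/
def Nodec (X : Type*) [TopologicalSpace X] : Prop :=
  ∀ A : Set X, IsNowhereDense A → IsClosed A

/-- Zero-dimensional: `T₁` with a base of clopen sets. -/
def ZeroDimensional (X : Type*) [TopologicalSpace X] : Prop :=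
  T1Space X ∧ IsTopologicalBasis {U : Set X | IsClopen U}

/-- The long Cantor set: the one-point compactification of `ω₁ × C`, where `ω₁` has the order
topology and `C = 2^ℕ` is the Cantor set. -/
abbrev LongCantor : Type 1 :=
  OnePoint (Iio (Ordinal.omega 1 : Ordinal.{0}) × (ℕ → Bool))

/-- The construction `M(X, K)` for a subspace `X` of `K` (where `K` is a compactification of `X`):
the subspace `(K × (Y \ {y})) ∪ (X × {y})` of `K × Y`, with `Y` the long Cantor set and
`y` its point at infinity. -/
def mSpace {K : Type*} (X : Set K) : Set (K × LongCantor) :=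
  (univ ×ˢ {OnePoint.infty}ᶜ) ∪ (X ×ˢ {OnePoint.infty})

/-! ### Nowhere dense sets, closures in subspaces, and the `ωN`-closure. -/

section General

variable {X : Type*} [TopologicalSpace X]

/-! A nowhere dense subset of `S \ {a}` is closed in the nodec dense set `S`, so `a ∉ X`. But `S \
{a} ⊆ X` is countable with closure the whole cube, so `X` is not `ω`-bounded. Countability of `S`
permits a diagonal argument (`exists_omegaN_subset_closure`) showing that `X` is `ωN`-bounded.
Second countable subspaces of an uncountable cube are nowhere dense
(`isNowhereDense_of_secondCountable`) and separable, whence `C₂`-boundedness.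

A nodec `S` arises by perturbing a countable dense `D`: each coordinate is changed only on a nowhere
dense set, and there are enough coordinates to separate every point from every nowhere dense set.

In `mSpace X` the top level is a nowhere dense copy of `X`, so failure of `ω`-boundedness becomes
failure of `ωN`-boundedness. `C₂`-boundedness survives because separable sets off the top level stay
away from it. -/

theorem isNowhereDense_iff_exists_isOpen_disjoint {s : Set X} :
    IsNowhereDense s ↔ ∀ U : Set X, IsOpen U → U.Nonempty →
      ∃ V ⊆ U, IsOpen V ∧ V.Nonempty ∧ Disjoint V s := by
  constructor
  · intro h U hU hne
    refine ⟨U \ closure s, sdiff_subset, hU.sdiff isClosed_closure, ?_,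
      disjoint_sdiff_left.mono_right subset_closure⟩
    by_contra hemp
    rw [not_nonempty_iff_eq_empty, sdiff_eq_empty] at hemp
    obtain ⟨x, hx⟩ := hne
    have : x ∈ interior (closure s) := interior_maximal hemp hU hx
    rw [h] at this
    exact this
  · intro h
    by_contra hne
    obtain ⟨V, hVU, hV, ⟨x, hx⟩, hd⟩ :=
      h _ isOpen_interior (nonempty_iff_ne_empty.mpr hne)
    exact (hd.closure_right hV).ne_of_mem hx (interior_subset (hVU hx)) rfl

theorem IsNowhereDense.union {s t : Set X} (hs : IsNowhereDense s) (ht : IsNowhereDense t) :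
    IsNowhereDense (s ∪ t) := by
  rw [isNowhereDense_iff_exists_isOpen_disjoint] at *
  intro U hU hne
  obtain ⟨V, hVU, hV, hVne, hVs⟩ := hs U hU hne
  obtain ⟨W, hWV, hW, hWne, hWt⟩ := ht V hV hVne
  exact ⟨W, hWV.trans hVU, hW, hWne, disjoint_union_right.mpr ⟨hVs.mono_left hWV, hWt⟩⟩

theorem Set.Finite.isNowhereDense_biUnion {β : Type*} {I : Set β} (hI : I.Finite) {s : β → Set X}
    (h : ∀ i ∈ I, IsNowhereDense (s i)) : IsNowhereDense (⋃ i ∈ I, s i) := by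
  induction I, hI using Set.Finite.induction_on with
  | empty => simp
  | insert _ _ ih =>
    rw [biUnion_insert]
    exact (h _ (mem_insert _ _)).union (ih fun i hi => h i (mem_insert_of_mem _ hi))

theorem IsNowhereDense.preimage_val {Y s : Set X} (hY : Dense Y) (hs : IsNowhereDense s) :
    IsNowhereDense ((↑) ⁻¹' s : Set Y) := by
  rw [isNowhereDense_iff_exists_isOpen_disjoint] at *
  rintro U hU ⟨x, hx⟩
  obtain ⟨U', hU', rfl⟩ := isOpen_induced_iff.mp hU
  obtain ⟨V, hVU, hV, hVne, hd⟩ := hs U' hU' ⟨x, hx⟩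
  obtain ⟨y, hyV, hyY⟩ := hY.inter_open_nonempty V hV hVne
  exact ⟨Subtype.val ⁻¹' V, preimage_mono hVU, hV.preimage continuous_subtype_val, ⟨⟨y, hyY⟩, hyV⟩,
    hd.preimage _⟩

/-- Reduces every boundedness property to closures in the ambient compact space. -/
theorem isCompact_closure_subtype_iff [CompactSpace X] [T2Space X] {Y : Set X} {A : Set Y} :
    IsCompact (closure A) ↔ closure ((↑) '' A : Set X) ⊆ Y := by
  constructor
  · intro h
    have h' : IsCompact ((↑) '' closure A : Set X) := h.image continuous_subtype_val
    exact (closure_minimal (image_mono subset_closure) h'.isClosed).trans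
      (Subtype.coe_image_subset _ _)
  · intro h
    rw [Topology.IsInducing.subtypeVal.isCompact_iff,
      Topology.IsInducing.subtypeVal.closure_eq_preimage_closure_image,
      Subtype.image_preimage_coe, inter_eq_right.mpr h]
    exact isClosed_closure.isCompact

theorem zeroDimensional_subtype [CompactSpace X] [T2Space X] [TotallyDisconnectedSpace X]
    (Y : Set X) : ZeroDimensional Y := by
  refine ⟨inferInstance, isTopologicalBasis_of_isOpen_of_nhds (fun U hU => hU.isOpen) ?_⟩
  intro y U hy hU
  obtain ⟨U', hU', rfl⟩ := isOpen_induced_iff.mp hU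
  obtain ⟨V, hV, hyV, hVU⟩ := compact_exists_isClopen_in_isOpen hU' hy
  exact ⟨Subtype.val ⁻¹' V, hV.preimage continuous_subtype_val, hyV, preimage_mono hVU⟩

/-- With a countable dense set around, the `ωN`-closure absorbs the countable nowhere dense
subsets of itself. -/
theorem exists_omegaN_subset_closure [RegularSpace X] {S : Set X} (hS : S.Countable)
    (hSd : Dense S) {Y B : Set X} (hBY : B ⊆ pClosure OmegaN Y) (hB : OmegaN B) :
    ∃ A ⊆ Y, OmegaN A ∧ B ⊆ closure A := by
  obtain ⟨f, hf⟩ := countable_iff_exists_injOn.mp hS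
  obtain ⟨g, hg⟩ := countable_iff_exists_injOn.mp hB.1
  have hA : ∀ b ∈ B, ∃ A : Set X, A ⊆ Y ∧ OmegaN A ∧ b ∈ closure A := by
    intro b hb
    simpa [pClosure, and_assoc] using hBY hb
  choose! A hAY hAN hAcl using hA
  have hV : ∀ s ∈ S \ closure B, ∃ V : Set X, IsOpen V ∧ s ∈ V ∧ closure V ⊆ (closure B)ᶜ := by
    intro s hs
    obtain ⟨V, hV, hVc, hVB⟩ := exists_mem_nhds_isClosed_subset
      (isClosed_closure.isOpen_compl.mem_nhds hs.2)
    exact ⟨interior V, isOpen_interior, mem_interior_iff_mem_nhds.mpr hV,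
      (closure_minimal interior_subset hVc).trans hVB⟩
  choose! V hVo hsV hVB using hV
  let T : X → Set X := fun b => {s ∈ S \ closure B | f s ≤ g b}
  let U : X → Set X := fun b => ⋂ s ∈ T b, (closure (V s))ᶜ
  have hTfin : ∀ b, (T b).Finite := fun b =>
    Set.Finite.of_finite_image ((finite_Iic (g b)).subset (image_subset_iff.mpr fun s hs => hs.2))
      (hf.mono fun s hs => hs.1.1)
  have hU : ∀ b, IsOpen (U b) := fun b =>
    (hTfin b).isOpen_biInter fun s _ => isClosed_closure.isOpen_compl
  have hbU : ∀ b ∈ B, b ∈ U b := by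
    intro b hb
    simp only [U, mem_iInter]
    exact fun s hs hbV => hVB s hs.1 hbV (subset_closure hb)
  refine ⟨⋃ b ∈ B, A b ∩ U b, iUnion₂_subset fun b hb => inter_subset_left.trans (hAY b hb),
    ⟨hB.1.biUnion fun b hb => (hAN b hb).1.mono inter_subset_left, ?_⟩, ?_⟩
  · rw [isNowhereDense_iff_exists_isOpen_disjoint]
    intro O hO hOne
    obtain ⟨O₁, hO₁O, hO₁, hO₁ne, hO₁B⟩ :=
      isNowhereDense_iff_exists_isOpen_disjoint.mp hB.2 O hO hOne
    obtain ⟨s, hsO, hsS⟩ := hSd.inter_open_nonempty O₁ hO₁ hO₁ne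
    have hs : s ∈ S \ closure B :=
      ⟨hsS, fun h => (hO₁B.closure_right hO₁).ne_of_mem hsO h rfl⟩
    have hfin : {b ∈ B | g b < f s}.Finite :=
      Set.Finite.of_finite_image ((finite_Iio (f s)).subset (image_subset_iff.mpr fun b hb => hb.2))
        (hg.mono fun b hb => hb.1)
    obtain ⟨W, hWO, hW, hWne, hWA⟩ := isNowhereDense_iff_exists_isOpen_disjoint.mp
      (hfin.isNowhereDense_biUnion fun b hb => (hAN b hb.1).2) (O₁ ∩ V s)
      (hO₁.inter (hVo s hs)) ⟨s, hsO, hsV s hs⟩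
    refine ⟨W, (hWO.trans inter_subset_left).trans hO₁O, hW, hWne, ?_⟩
    rw [Set.disjoint_left] at hWA ⊢
    intro x hx hxA
    obtain ⟨b, hb, hxb, hxU⟩ := mem_iUnion₂.mp hxA
    rcases lt_or_ge (g b) (f s) with h | h
    · exact hWA hx (mem_biUnion (show b ∈ {b ∈ B | g b < f s} from ⟨hb, h⟩) hxb)
    · exact mem_iInter₂.mp hxU s ⟨hs, h⟩ (subset_closure (hWO hx).2)
  · intro b hb
    refine closure_mono (subset_biUnion_of_mem (u := fun b => A b ∩ U b) hb) ?_
    rw [inter_comm]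
    exact (hU b).inter_closure ⟨hbU b hb, hAcl b hb⟩

/-- Density of `S` makes the trace on `S` of a nowhere dense set nowhere dense in `S`, hence closed
there. -/
theorem Nodec.notMem_pClosure_omegaN {S : Set X} (hSd : Dense S) (hS : Nodec S) {a : X}
    (ha : a ∈ S) : a ∉ pClosure OmegaN (S \ {a}) := by
  intro h
  obtain ⟨A, hAS, hA, haA⟩ : ∃ A, A ⊆ S \ {a} ∧ OmegaN A ∧ a ∈ closure A := by
    simpa [pClosure, and_assoc] using h
  have hcl := hS _ (hA.2.preimage_val hSd)
  have : (⟨a, ha⟩ : S) ∈ closure ((↑) ⁻¹' A : Set S) := by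
    rw [Topology.IsInducing.subtypeVal.closure_eq_preimage_closure_image,
      Subtype.image_preimage_coe, inter_eq_right.mpr (hAS.trans sdiff_subset)]
    exact haA
  rw [hcl.closure_eq] at this
  exact (hAS this).2 rfl

theorem subset_pClosure_omegaN [T1Space X] [∀ x : X, (nhdsWithin x {x}ᶜ).NeBot] (Y : Set X) :
    Y ⊆ pClosure OmegaN Y := by
  intro y hy
  have hN : OmegaN ({y} : Set X) :=
    ⟨countable_singleton y, by rw [isClosed_singleton.isNowhereDense_iff, interior_singleton]⟩
  exact mem_biUnion (show ({y} : Set X) ∈ {A | A ⊆ Y ∧ OmegaN A} from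
    ⟨singleton_subset_iff.mpr hy, hN⟩) (subset_closure rfl)

end General

/-! ### Cylinders and second countable subspaces of Cantor cubes. -/

section CantorCube

variable {ι : Type*}

theorem exists_finset_cylinder_subset {U : Set (ι → Bool)} (hU : IsOpen U) {x : ι → Bool}
    (hx : x ∈ U) : ∃ F : Finset ι, {y | ∀ i ∈ F, y i = x i} ⊆ U := by
  obtain ⟨F, u, hu, hFU⟩ := isOpen_pi_iff.mp hU x hx
  exact ⟨F, fun y hy => hFU fun i hi => by rw [hy i hi]; exact (hu i hi).2⟩

theorem isOpen_setOf_apply_eq (i : ι) (v : Bool) : IsOpen {y : ι → Bool | y i = v} :=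
  (isOpen_discrete ({v} : Set Bool)).preimage (continuous_apply (A := fun _ : ι => Bool) i)

theorem isOpen_cylinder (F : Finset ι) (x : ι → Bool) :
    IsOpen {y : ι → Bool | ∀ i ∈ F, y i = x i} := by
  have : {y : ι → Bool | ∀ i ∈ F, y i = x i} = ⋂ i ∈ F, {y | y i = x i} := by
    ext; simp
  rw [this]
  exact isOpen_biInter_finset fun i _ => isOpen_setOf_apply_eq i (x i)

instance neBot_nhdsNE_cantorCube [Infinite ι] (x : ι → Bool) :
    (nhdsWithin x {x}ᶜ).NeBot := by
  classical
  rw [← mem_closure_iff_nhdsWithin_neBot, mem_closure_iff]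
  intro U hU hx
  obtain ⟨F, hF⟩ := exists_finset_cylinder_subset hU hx
  obtain ⟨i, hi⟩ := Infinite.exists_notMem_finset F
  refine ⟨Function.update x i (!x i), hF fun j hj => ?_, fun h => ?_⟩
  · exact Function.update_of_ne (ne_of_mem_of_not_mem hj hi) _ _
  · simpa using congrFun h i

/-- In an uncountable Cantor cube, second countable subspaces are nowhere dense. -/
theorem isNowhereDense_of_secondCountable [Uncountable ι] {B : Set (ι → Bool)}
    (hB : SecondCountableTopology B) : IsNowhereDense B := by
  classical
  rw [isNowhereDense_iff_exists_isOpen_disjoint]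
  by_contra! hnot
  obtain ⟨W, hW, hWne, hWB⟩ := hnot
  have hmeet : ∀ V ⊆ W, IsOpen V → V.Nonempty → ∃ x ∈ B, x ∈ V := by
    intro V hVW hV hVne
    obtain ⟨x, hxV, hxB⟩ := Set.not_disjoint_iff.mp (hWB V hVW hV hVne)
    exact ⟨x, hxB, hxV⟩
  have hbas := isBasis_countableBasis B
  -- Each relevant `O` contains the trace on `B` of a cylinder with finite support `F`. A coordinate
  -- `i` outside the countably many supports gives the contradiction: a basic set inside `{y i =
  -- true}` would contain a point with `i`-th value `false`.
  have hext : ∀ O : Set B, ∃ F : Finset ι, ∃ z : ι → Bool, IsOpen O →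
      (O ∩ (↑) ⁻¹' W).Nonempty → z ∈ W ∧ {y | ∀ i ∈ F, y i = z i} ⊆ W ∧
        ∀ b : B, (∀ i ∈ F, b.1 i = z i) → b ∈ O := by
    intro O
    by_cases h : IsOpen O ∧ (O ∩ (↑) ⁻¹' W).Nonempty
    · obtain ⟨hO, b, hbO, hbW⟩ := h
      obtain ⟨O', hO', rfl⟩ := isOpen_induced_iff.mp hO
      obtain ⟨F, hF⟩ := exists_finset_cylinder_subset (hO'.inter hW) ⟨hbO, hbW⟩
      exact ⟨F, b, fun _ _ => ⟨hbW, fun y hy => (hF hy).2, fun c hc => (hF hc).1⟩⟩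
    · exact ⟨∅, fun _ => true, fun h₁ h₂ => (h ⟨h₁, h₂⟩).elim⟩
  choose F z hFz using hext
  obtain ⟨w, hw⟩ := hWne
  obtain ⟨G, hG⟩ := exists_finset_cylinder_subset hW hw
  have hcount : ((⋃ O ∈ countableBasis B, (F O : Set ι)) ∪ (G : Set ι)).Countable :=
    ((countable_countableBasis B).biUnion fun O _ => (F O).countable_toSet).union
      G.countable_toSet
  obtain ⟨i, hi⟩ : ∃ i, i ∉ (⋃ O ∈ countableBasis B, (F O : Set ι)) ∪ (G : Set ι) := by
    by_contra! h
    exact not_countable_univ (hcount.mono fun i _ => h i)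
  obtain ⟨b, hbB, hbW, hbi⟩ := hmeet (W ∩ {y | y i = true}) inter_subset_left
    (hW.inter (isOpen_setOf_apply_eq i true)) ⟨Function.update w i true, hG fun j hj =>
      Function.update_of_ne (ne_of_mem_of_not_mem hj fun h => hi (Or.inr h)) _ _, by simp⟩
  obtain ⟨O, hO, hbO, hOsub⟩ := hbas.exists_subset_of_mem_open
    (show (⟨b, hbB⟩ : B) ∈ ((↑) ⁻¹' {y : ι → Bool | y i = true} : Set B) from hbi)
    ((isOpen_setOf_apply_eq i true).preimage continuous_subtype_val)
  obtain ⟨hzW, hzsub, hzO⟩ := hFz O (hbas.isOpen hO) ⟨⟨b, hbB⟩, hbO, hbW⟩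
  have hiF : i ∉ F O := fun h => hi (Or.inl (mem_biUnion hO h))
  obtain ⟨c, hcB, hcF, hci⟩ := hmeet ({y | ∀ j ∈ F O, y j = z O j} ∩ {y | y i = false})
    (inter_subset_left.trans hzsub) ((isOpen_cylinder _ _).inter (isOpen_setOf_apply_eq i false))
    ⟨Function.update (z O) i false, fun j hj =>
      Function.update_of_ne (ne_of_mem_of_not_mem hj hiF) _ _, by simp⟩
  have : c i = true := hOsub (hzO ⟨c, hcB⟩ hcF)
  exact Bool.false_ne_true ((show c i = false from hci).symm.trans this)

end CantorCube

/-! ### A countable dense nodec subspace by perturbation. -/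

section NodecSubspace

variable {ι : Type*}

theorem exists_countable_dense_cantorCube (hι : Cardinal.mk ι = Cardinal.continuum) :
    ∃ D : Set (ι → Bool), D.Countable ∧ Dense D := by
  classical
  obtain ⟨g⟩ : Nonempty (ι ≃ (ℕ → Bool)) := by
    rw [← Cardinal.lift_mk_eq', hι]
    simp
  have : Countable (Clopens (ℕ → Bool)) :=
    Clopens.countable_iff_secondCountable.mpr inferInstance
  -- With `ι` identified with the Cantor set, indicators of its countably many clopen sets are
  -- dense, since disjoint finite sets are separated by a clopen set.
  refine ⟨range fun (U : Clopens (ℕ → Bool)) (i : ι) => decide (g i ∈ U),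
    countable_range _, dense_iff_inter_open.mpr ?_⟩
  rintro U hU ⟨x, hx⟩
  obtain ⟨F, hF⟩ := exists_finset_cylinder_subset hU hx
  have hfin : ∀ v : Bool, (g '' {i | i ∈ F ∧ x i = v}).Finite := fun v =>
    (F.finite_toSet.subset fun i hi => hi.1).image g
  obtain ⟨C, hC, hZC, hCO⟩ := exists_clopen_of_closed_subset_open (hfin true).isClosed
    (hfin false).isClosed.isOpen_compl (by
      rintro _ ⟨i, hi, rfl⟩ ⟨j, hj, hij⟩
      rw [g.injective hij] at hj
      exact Bool.false_ne_true (hj.2.symm.trans hi.2))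
  refine ⟨_, hF fun i hi => ?_, ⟨⟨C, hC⟩, rfl⟩⟩
  change decide (g i ∈ C) = x i
  cases h : x i with
  | true => exact decide_eq_true (hZC ⟨i, ⟨hi, h⟩, rfl⟩)
  | false => exact decide_eq_false fun hiC => hCO hiC ⟨i, ⟨hi, h⟩, rfl⟩

variable {D : Set (ι → Bool)} {Φ : D → ι → Bool}

/-- If each coordinate of the points of `D` is changed only on a nowhere dense set, then a set
that is dense in a cylinder still meets this cylinder after the change. -/
theorem exists_mem_perturbation_cylinder (hD : Dense D)
    (hΦ : ∀ i, IsNowhereDense {d : D | Φ d i ≠ d.1 i}) (F : Finset ι) (x : ι → Bool) (T : Set D)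
    (hT : ∀ U ⊆ {y | ∀ i ∈ F, y i = x i}, IsOpen U → U.Nonempty → ∃ d ∈ T, d.1 ∈ U) :
    ∃ d ∈ T, ∀ i ∈ F, Φ d i = x i := by
  obtain ⟨d₀, hd₀, hd₀D⟩ := hD.inter_open_nonempty _ (isOpen_cylinder F x) ⟨x, fun _ _ => rfl⟩
  obtain ⟨V, hVc, hV, ⟨v, hv⟩, hVN⟩ := isNowhereDense_iff_exists_isOpen_disjoint.mp
    (F.finite_toSet.isNowhereDense_biUnion fun i _ => hΦ i)
    (Subtype.val ⁻¹' {y | ∀ i ∈ F, y i = x i})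
    ((isOpen_cylinder F x).preimage continuous_subtype_val) ⟨⟨d₀, hd₀D⟩, hd₀⟩
  obtain ⟨V', hV', rfl⟩ := isOpen_induced_iff.mp hV
  obtain ⟨d, hdT, hdV, hdF⟩ := hT (V' ∩ {y | ∀ i ∈ F, y i = x i}) inter_subset_right
    (hV'.inter (isOpen_cylinder F x)) ⟨v, hv, hVc hv⟩
  refine ⟨d, hdT, fun i hi => ?_⟩
  by_contra hne
  refine Set.disjoint_left.mp hVN (show d ∈ Subtype.val ⁻¹' V' from hdV)
    (mem_biUnion (Finset.mem_coe.mpr hi) ?_)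
  exact fun h => hne (h.trans (hdF i hi))

theorem denseRange_perturbation (hD : Dense D)
    (hΦ : ∀ i, IsNowhereDense {d : D | Φ d i ≠ d.1 i}) : DenseRange Φ := by
  refine dense_iff_inter_open.mpr ?_
  rintro U hU ⟨x, hx⟩
  obtain ⟨F, hF⟩ := exists_finset_cylinder_subset hU hx
  obtain ⟨d, -, hd⟩ := exists_mem_perturbation_cylinder hD hΦ F x univ fun U _ hU hUne => by
    obtain ⟨y, hyU, hyD⟩ := hD.inter_open_nonempty U hU hUne
    exact ⟨⟨y, hyD⟩, mem_univ _, hyU⟩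
  exact ⟨Φ d, hF hd, mem_range_self d⟩

/-- If the preimage were dense in an open set, it would be dense in a cylinder missing `B`, and some
perturbed point of it would still lie in that cylinder. -/
theorem isNowhereDense_preimage_perturbation (hD : Dense D)
    (hΦ : ∀ i, IsNowhereDense {d : D | Φ d i ≠ d.1 i}) {B : Set (ι → Bool)}
    (hB : IsNowhereDense B) : IsNowhereDense (Φ ⁻¹' B) := by
  rw [isNowhereDense_iff_exists_isOpen_disjoint]
  by_contra! hnot
  obtain ⟨U, hU, ⟨u, hu⟩, hUB⟩ := hnot
  obtain ⟨U', hU', rfl⟩ := isOpen_induced_iff.mp hU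
  obtain ⟨V, hVU, hV, ⟨v, hv⟩, hVB⟩ :=
    isNowhereDense_iff_exists_isOpen_disjoint.mp hB U' hU' ⟨u, hu⟩
  obtain ⟨F, hF⟩ := exists_finset_cylinder_subset hV hv
  obtain ⟨d, hdB, hd⟩ := exists_mem_perturbation_cylinder hD hΦ F v (Φ ⁻¹' B)
    fun W hWF hW hWne => by
      obtain ⟨y, hyW, hyD⟩ := hD.inter_open_nonempty W hW hWne
      obtain ⟨d, hdW, hdB⟩ := Set.not_disjoint_iff.mp (hUB (Subtype.val ⁻¹' W)
        (preimage_mono ((hWF.trans hF).trans hVU)) (hW.preimage continuous_subtype_val)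
        ⟨⟨y, hyD⟩, hyW⟩)
      exact ⟨d, hdB, hdW⟩
  exact Set.disjoint_left.mp hVB (hF hd) hdB

/-- The Cantor cube of weight continuum has a countable dense nodec subspace. -/
theorem exists_countable_dense_nodec (hι : Cardinal.mk ι = Cardinal.continuum) :
    ∃ S : Set (ι → Bool), S.Countable ∧ Dense S ∧ Nodec S := by
  classical
  have : Infinite ι := Cardinal.aleph0_le_mk_iff.mp (hι ▸ Cardinal.aleph0_le_continuum)
  obtain ⟨D, hDc, hD⟩ := exists_countable_dense_cantorCube hι
  have : Countable D := hDc.to_subtype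
  have : Nonempty D := hD.nonempty.to_subtype
  obtain ⟨g, hg⟩ : ∃ g : ι → Set D × D, Function.Surjective g := by
    have hle : Cardinal.mk (Set D × D) ≤ Cardinal.mk ι := by
      rw [hι, Cardinal.mk_prod, Cardinal.mk_set, Cardinal.lift_id, Cardinal.lift_id]
      have h1 : Cardinal.mk D ≤ Cardinal.aleph0 := Cardinal.mk_le_aleph0
      calc _ ≤ 2 ^ Cardinal.aleph0 * Cardinal.aleph0 :=
            mul_le_mul' (Cardinal.power_le_power_left two_ne_zero h1) h1
        _ = _ := by simp
    obtain ⟨f⟩ := hle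
    exact ⟨Function.invFun f, Function.invFun_surjective f.injective⟩
  -- The coordinate coding `(A, p)` with `A` nowhere dense is altered only on `A ∪ {p}`, so that `{y
  -- i = true}` contains `Φ p` and misses `Φ d` for `d ∈ A`, `d ≠ p`.
  let Φ : D → ι → Bool := fun d i =>
    if IsNowhereDense (g i).1 then
      if d = (g i).2 then true else if d ∈ (g i).1 then false else d.1 i
    else d.1 i
  have hsing : ∀ p : D, IsNowhereDense ({p} : Set D) := by
    intro p
    have h : IsNowhereDense ({p.1} : Set (ι → Bool)) := by
      rw [isClosed_singleton.isNowhereDense_iff, interior_singleton]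
    exact (h.preimage_val hD).mono fun q hq => congrArg Subtype.val hq
  have hΦ : ∀ i, IsNowhereDense {d : D | Φ d i ≠ d.1 i} := by
    intro i
    by_cases h : IsNowhereDense (g i).1
    · refine (h.union (hsing (g i).2)).mono fun d hd => ?_
      by_contra hnot
      simp only [mem_union, mem_singleton_iff, not_or] at hnot
      exact hd (by simp [Φ, h, hnot.1, hnot.2])
    · simp [Φ, h]
  refine ⟨range Φ, countable_range Φ, denseRange_perturbation hD hΦ, fun B hB => ?_⟩
  have hA : IsNowhereDense (Φ ⁻¹' (Subtype.val '' B)) :=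
    isNowhereDense_preimage_perturbation hD hΦ hB.image_val
  rw [← isOpen_compl_iff, isOpen_iff_forall_mem_open]
  rintro ⟨_, p, rfl⟩ hp
  obtain ⟨i, hi⟩ := hg (Φ ⁻¹' (Subtype.val '' B), p)
  refine ⟨Subtype.val ⁻¹' {y | y i = true}, ?_,
    (isOpen_setOf_apply_eq i true).preimage continuous_subtype_val, ?_⟩
  · rintro ⟨_, d, rfl⟩ hd hdB
    have hdA : d ∈ Φ ⁻¹' (Subtype.val '' B) := ⟨_, hdB, rfl⟩
    have hdp : d ≠ p := by
      rintro rfl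
      exact hp hdB
    have h1 : Φ d i = true := hd
    have h2 : Φ d i = false := by
      simp only [Φ]
      rw [hi, if_pos hA, if_neg hdp, if_pos hdA]
    exact Bool.false_ne_true (h2.symm.trans h1)
  · change Φ p i = true
    simp only [Φ]
    rw [hi, if_pos hA, if_pos rfl]

end NodecSubspace

/-! ### Boundedness in `ω₁` and clopen sets of the long Cantor set. -/

section LongCantor

/-- The space of countable ordinals. -/
abbrev OmegaOne : Type 1 := Iio (Ordinal.omega 1 : Ordinal.{0})

instance : Nonempty OmegaOne := ⟨⟨0, Ordinal.omega_pos 1⟩⟩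

theorem exists_forall_le_of_countable_omega_one {A : Set OmegaOne} (hA : A.Countable) :
    ∃ α : OmegaOne, ∀ β ∈ A, β ≤ α := by
  have : Countable A := hA.to_subtype
  refine ⟨⟨⨆ β : A, β.1.1, Ordinal.iSup_lt_omega_one fun β => β.1.2⟩, fun β hβ => ?_⟩
  exact Ordinal.le_iSup (fun β : A => β.1.1) ⟨β, hβ⟩

theorem exists_gt_omega_one (α : OmegaOne) : ∃ β : OmegaOne, α < β :=
  ⟨⟨Order.succ α.1, (Cardinal.isSuccLimit_omega 1).succ_lt α.2⟩, Order.lt_succ α.1⟩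

theorem isClopen_Iic_omega_one (α : OmegaOne) : IsClopen (Iic α) := by
  refine ⟨isClosed_Iic (a := α.1) |>.preimage continuous_subtype_val, ?_⟩
  have : Iic α = Subtype.val ⁻¹' Iio (Order.succ α.1) := by
    ext β; simp
  rw [this]
  exact isOpen_Iio.preimage continuous_subtype_val

theorem isCompact_Iic_omega_one (α : OmegaOne) : IsCompact (Iic α) := by
  rw [Topology.IsInducing.subtypeVal.isCompact_iff]
  have : Subtype.val '' Iic α = Icc 0 α.1 := by
    ext β
    constructor
    · rintro ⟨γ, hγ, rfl⟩
      exact ⟨zero_le, hγ⟩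
    · intro h
      exact ⟨⟨β, h.2.trans_lt α.2⟩, h.2, rfl⟩
  rw [this]
  exact isCompact_Icc

instance noncompactSpace_omega_one_prod : NoncompactSpace (OmegaOne × (ℕ → Bool)) := by
  refine ⟨fun h => ?_⟩
  have h' : IsCompact (univ : Set OmegaOne) := by
    simpa [Set.range_eq_univ.mpr (Prod.fst_surjective (α := OmegaOne) (β := ℕ → Bool))] using
      h.image continuous_fst
  obtain ⟨_, ⟨α, -, rfl⟩, hα⟩ := (h'.image continuous_subtype_val).exists_isGreatest
    (univ_nonempty.image _)
  obtain ⟨β, hβ⟩ := exists_gt_omega_one α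
  exact (hα ⟨β, mem_univ _, rfl⟩).not_gt hβ

theorem isClopen_coe_image_longCantor {s : Set (OmegaOne × (ℕ → Bool))} (hs : IsClopen s)
    {α : OmegaOne} (hα : ∀ z ∈ s, z.1 ≤ α) : IsClopen ((↑) '' s : Set LongCantor) := by
  refine ⟨OnePoint.isClosed_image_coe.mpr ⟨hs.1, ?_⟩, OnePoint.isOpen_image_coe.mpr hs.2⟩
  exact ((isCompact_Iic_omega_one α).prod isCompact_univ).of_isClosed_subset hs.1
    fun z hz => ⟨hα z hz, mem_univ _⟩

theorem isClopen_fst_le (α : OmegaOne) : IsClopen {z : OmegaOne × (ℕ → Bool) | z.1 ≤ α} :=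
  (isClopen_Iic_omega_one α).preimage continuous_fst

instance totallySeparatedSpace_longCantor : TotallySeparatedSpace LongCantor := by
  -- Here `z` is the lower point, with infinity above everything: a compact clopen initial segment
  -- separates different levels, a Cantor coordinate separates points of one level.
  have key : ∀ (z : OmegaOne × (ℕ → Bool)) (w : LongCantor), (z : LongCantor) ≠ w →
      (∀ z' : OmegaOne × (ℕ → Bool), w = z' → z.1 ≤ z'.1) →
      ∃ U : Set LongCantor, IsClopen U ∧ (z : LongCantor) ∈ U ∧ w ∉ U := by
    rintro z w hzw hle
    induction w using OnePoint.rec with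
    | infty =>
      exact ⟨_, isClopen_coe_image_longCantor (isClopen_fst_le z.1) fun _ h => h,
        ⟨z, le_refl z.1, rfl⟩, OnePoint.infty_notMem_image_coe⟩
    | coe w =>
      have hne : z ≠ w := fun h => hzw (congrArg _ h)
      rcases (hle w rfl).lt_or_eq with h | h
      · refine ⟨_, isClopen_coe_image_longCantor (isClopen_fst_le z.1) fun _ h => h,
          ⟨z, le_refl z.1, rfl⟩, ?_⟩
        rintro ⟨v, hv, hvw⟩
        rw [OnePoint.coe_injective hvw] at hv
        exact h.not_ge hv
      · obtain ⟨n, hn⟩ : ∃ n, z.2 n ≠ w.2 n :=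
          Function.ne_iff.mp fun h2 => hne (Prod.ext h h2)
        have hcl : IsClopen {v : OmegaOne × (ℕ → Bool) | v.2 n = z.2 n} :=
          (isClopen_discrete ({z.2 n} : Set Bool)).preimage
            ((continuous_apply n).comp continuous_snd)
        refine ⟨_, isClopen_coe_image_longCantor ((isClopen_fst_le z.1).inter hcl)
          fun _ h => h.1, ⟨z, ⟨le_refl z.1, rfl⟩, rfl⟩, ?_⟩
        rintro ⟨v, hv, hvw⟩
        rw [OnePoint.coe_injective hvw] at hv
        exact hn hv.2.symm
  rw [totallySeparatedSpace_iff_exists_isClopen]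
  intro x y hxy
  have swap : (∃ U : Set LongCantor, IsClopen U ∧ y ∈ U ∧ x ∉ U) →
      ∃ U : Set LongCantor, IsClopen U ∧ x ∈ U ∧ y ∈ Uᶜ :=
    fun ⟨U, hU, hy, hx⟩ => ⟨Uᶜ, hU.compl, hx, not_not.mpr hy⟩
  induction x using OnePoint.rec with
  | infty =>
    induction y using OnePoint.rec with
    | infty => exact (hxy rfl).elim
    | coe y => exact swap (key y _ hxy.symm fun z' h => (OnePoint.infty_ne_coe z' h).elim)
  | coe x =>
    induction y using OnePoint.rec with
    | infty => exact key x _ hxy fun z' h => (OnePoint.infty_ne_coe z' h).elim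
    | coe y =>
      rcases le_total x.1 y.1 with h | h
      · exact key x y hxy fun z' hz => by rwa [← OnePoint.coe_injective hz]
      · exact swap (key y x hxy.symm fun z' hz => by rwa [← OnePoint.coe_injective hz])

end LongCantor

/-! ### Boundedness of `mSpace`. -/

section MSpace

variable {K : Type*} [TopologicalSpace K]

theorem c2Bounded_iff_closure_subset [CompactSpace K] [T2Space K] {X : Set K} :
    C2Bounded X ↔ ∀ B ⊆ X, SecondCountableTopology B → closure B ⊆ X := by
  constructor
  · intro h B hBX hB
    have hBX' : Subtype.val '' (Subtype.val ⁻¹' B : Set X) = B := by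
      rw [Subtype.image_preimage_coe, inter_eq_right.mpr hBX]
    have hval : Topology.IsInducing fun x : (Subtype.val ⁻¹' B : Set X) => x.1.1 :=
      Topology.IsInducing.subtypeVal.comp Topology.IsInducing.subtypeVal
    have hind : Topology.IsInducing
        (fun x : (Subtype.val ⁻¹' B : Set X) => (⟨x.1.1, x.2⟩ : B)) :=
      .of_comp (hval.continuous.subtype_mk _) continuous_subtype_val hval
    have := isCompact_closure_subtype_iff.mp
      (h (Subtype.val ⁻¹' B) hind.secondCountableTopology)
    rwa [hBX'] at this
  · intro h A (hA : SecondCountableTopology A)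
    rw [isCompact_closure_subtype_iff]
    refine h _ (Subtype.coe_image_subset _ _) ?_
    have e : A ≃ₜ (Subtype.val '' A : Set K) :=
      Topology.IsEmbedding.subtypeVal.homeomorphImage A
    exact e.symm.isInducing.secondCountableTopology

theorem c2Bounded_mSpace [CompactSpace K] [T2Space K] {X : Set K} (hX : C2Bounded X) :
    C2Bounded (mSpace X) := by
  rw [c2Bounded_iff_closure_subset] at hX ⊢
  rintro C hCM hC ⟨k, l⟩ hkl
  by_cases hl : l = OnePoint.infty
  swap
  · exact Or.inl ⟨mem_univ _, hl⟩
  subst hl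
  refine Or.inr ⟨?_, rfl⟩
  let s : Set (K × LongCantor) := univ ×ˢ {OnePoint.infty}
  rw [← inter_union_sdiff C s, closure_union] at hkl
  rcases hkl with hkl | hkl
  · let E : Set K := {x | (x, OnePoint.infty) ∈ C}
    have hEX : E ⊆ X := by
      intro x hx
      rcases hCM hx with h | h
      · exact (h.2 rfl).elim
      · exact h.1
    have hE : SecondCountableTopology E := by
      have hind : Topology.IsInducing
          (fun x : E => (⟨(x.1, OnePoint.infty), x.2⟩ : C)) :=
        .of_comp (Continuous.subtype_mk (by fun_prop) _)
          (continuous_fst.comp continuous_subtype_val) Topology.IsInducing.subtypeVal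
      exact hind.secondCountableTopology
    refine hX E hEX hE ?_
    have hsub : closure (C ∩ s) ⊆ Prod.fst ⁻¹' closure E := by
      refine closure_minimal ?_ (isClosed_closure.preimage continuous_fst)
      rintro ⟨x, y⟩ ⟨hxC, -, hy⟩
      obtain rfl : y = OnePoint.infty := hy
      exact subset_closure hxC
    exact hsub hkl
  -- A countable dense subset of `C \ s` has first `ω₁`-coordinates bounded by some `α`, so the
  -- closure avoids infinity.
  · exfalso
    obtain ⟨T, hTC, hTc, hT⟩ : ∃ T ⊆ C \ s, T.Countable ∧ C \ s ⊆ closure T := by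
      have : SecondCountableTopology (C \ s : Set (K × LongCantor)) :=
        (Topology.IsEmbedding.inclusion (sdiff_subset (s := C) (t := s))).isInducing.secondCountableTopology
      obtain ⟨T, hTc, hTd⟩ := exists_countable_dense (C \ s : Set (K × LongCantor))
      refine ⟨Subtype.val '' T, Subtype.coe_image_subset _ _, hTc.image _, ?_⟩
      exact Subtype.dense_iff.mp hTd
    have hcoord : ∀ p ∈ T, ∃ z : OmegaOne × (ℕ → Bool),
        (z : LongCantor) = p.2 := fun p hp =>
      OnePoint.ne_infty_iff_exists.mp fun h => (hTC hp).2 ⟨mem_univ _, h⟩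
    choose! f hf using hcoord
    obtain ⟨α, hα⟩ := exists_forall_le_of_countable_omega_one
      (hTc.image fun p => (f p).1)
    have hcl : IsClosed (univ ×ˢ ((↑) '' {z : OmegaOne × (ℕ → Bool) |
        z.1 ≤ α}) : Set (K × LongCantor)) :=
      isClosed_univ.prod (isClopen_coe_image_longCantor (isClopen_fst_le α) fun _ h => h).1
    have hTsub : T ⊆ univ ×ˢ ((↑) '' {z : OmegaOne × (ℕ → Bool) |
        z.1 ≤ α}) := fun p hp => ⟨mem_univ _, f p, hα _ ⟨p, hp, rfl⟩, hf p hp⟩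
    have := closure_minimal (hT.trans (closure_minimal hTsub hcl)) hcl hkl
    exact OnePoint.infty_notMem_image_coe this.2

theorem not_omegaNBounded_mSpace [CompactSpace K] [T2Space K] {X : Set K}
    (hX : ¬ OmegaBounded X) : ¬ OmegaNBounded (mSpace X) := by
  refine fun h => hX fun A hA => ?_
  rw [isCompact_closure_subtype_iff]
  let j : X → mSpace X := fun x => ⟨(x.1, OnePoint.infty), Or.inr ⟨x.2, rfl⟩⟩
  have hnwd : IsNowhereDense (j '' A) := by
    rw [isNowhereDense_iff_exists_isOpen_disjoint]
    rintro U hU ⟨x, hx⟩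
    obtain ⟨U', hU', rfl⟩ := isOpen_induced_iff.mp hU
    have hd : Dense (univ ×ˢ {OnePoint.infty}ᶜ : Set (K × LongCantor)) :=
      -- Noncompactness of `ω₁ × 2^ω` is what makes the complement of infinity dense.
      dense_univ.prod (OnePoint.compl_infty (X := OmegaOne × (ℕ → Bool)) ▸ OnePoint.denseRange_coe)
    have ho : IsOpen (univ ×ˢ {OnePoint.infty}ᶜ : Set (K × LongCantor)) :=
      isOpen_univ.prod isOpen_compl_singleton
    obtain ⟨p, hpU, hp⟩ := hd.inter_open_nonempty U' hU' ⟨_, hx⟩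
    refine ⟨Subtype.val ⁻¹' (U' ∩ univ ×ˢ {OnePoint.infty}ᶜ), preimage_mono inter_subset_left,
      (hU'.inter ho).preimage continuous_subtype_val, ⟨⟨p, Or.inl hp⟩, hpU, hp⟩, ?_⟩
    rw [Set.disjoint_left]
    rintro _ hq ⟨a, -, rfl⟩
    exact hq.2.2 rfl
  have hcl := isCompact_closure_subtype_iff.mp (h (j '' A) ⟨hA.image j, hnwd⟩)
  intro k hk
  have hmem : (k, OnePoint.infty) ∈ closure (Subtype.val '' (j '' A)) := by
    have hc : Continuous fun k : K => (k, (OnePoint.infty : LongCantor)) := by fun_prop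
    refine closure_mono ?_ (image_closure_subset_closure_image hc ⟨k, hk, rfl⟩)
    rintro _ ⟨_, ⟨a, ha, rfl⟩, rfl⟩
    exact ⟨j a, ⟨a, ha, rfl⟩, rfl⟩
  rcases hcl hmem with h | h
  · exact (h.2 rfl).elim
  · exact h.1

end MSpace

/-! ### Assembly of the two examples. -/

theorem mainTheorem11 (ι : Type*) (hι : Cardinal.mk ι = Cardinal.continuum) :
    (∃ S : Set (ι → Bool), S.Countable ∧ Dense S ∧ Nodec S) ∧
    ∀ S : Set (ι → Bool), S.Countable → Dense S → Nodec S → ∀ a ∈ S,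
      ∀ X : Set (ι → Bool), X = pClosure OmegaN (S \ {a}) →
        (ZeroDimensional X ∧ OmegaNBounded X ∧ C2Bounded X ∧ ¬ OmegaBounded X) ∧
        -- so that the compact space `2^ι` is a compactification of `X`
        Dense X ∧
        (ZeroDimensional (mSpace X) ∧ C2Bounded (mSpace X) ∧ ¬ OmegaNBounded (mSpace X)) := by
  refine ⟨exists_countable_dense_nodec hι, ?_⟩
  rintro S hSc hSd hSn a ha X rfl
  have : Uncountable ι := by
    rw [← Cardinal.aleph0_lt_mk_iff, hι]
    exact Cardinal.aleph0_lt_continuum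
  have hSX : S \ {a} ⊆ pClosure OmegaN (S \ {a}) := subset_pClosure_omegaN _
  have hSad : Dense (S \ {a}) := hSd.sdiff_singleton a
  have hXd : Dense (pClosure OmegaN (S \ {a})) := hSad.mono hSX
  have hN : ∀ B ⊆ pClosure OmegaN (S \ {a}), OmegaN B →
      closure B ⊆ pClosure OmegaN (S \ {a}) := by
    intro B hBX hB
    obtain ⟨A, hAY, hA, hBA⟩ := exists_omegaN_subset_closure hSc hSd hBX hB
    exact (closure_minimal hBA isClosed_closure).trans
      (subset_biUnion_of_mem (u := closure)
        (show A ∈ {A | A ⊆ S \ {a} ∧ OmegaN A} from ⟨hAY, hA⟩))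
  have hC2 : C2Bounded (pClosure OmegaN (S \ {a})) := by
    rw [c2Bounded_iff_closure_subset]
    intro B hBX hB
    obtain ⟨T, hTc, hTd⟩ := exists_countable_dense B
    have hBT : B ⊆ closure (Subtype.val '' T) := Subtype.dense_iff.mp hTd
    have hTB : Subtype.val '' T ⊆ B := Subtype.coe_image_subset _ _
    exact (closure_minimal hBT isClosed_closure).trans (hN _ (hTB.trans hBX)
      ⟨hTc.image _, (isNowhereDense_of_secondCountable hB).mono hTB⟩)
  have hω : ¬ OmegaBounded (pClosure OmegaN (S \ {a})) := by
    intro h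
    have hcl := isCompact_closure_subtype_iff.mp
      (h (Subtype.val ⁻¹' (S \ {a})) ((hSc.mono sdiff_subset).preimage Subtype.val_injective))
    rw [Subtype.image_preimage_coe, inter_eq_right.mpr hSX, hSad.closure_eq] at hcl
    exact hSn.notMem_pClosure_omegaN hSd ha (hcl (mem_univ a))
  refine ⟨⟨zeroDimensional_subtype _, fun A hA => ?_, hC2, hω⟩, hXd,
    zeroDimensional_subtype _, c2Bounded_mSpace hC2, not_omegaNBounded_mSpace hω⟩
  rw [isCompact_closure_subtype_iff]
  exact hN _ (Subtype.coe_image_subset _ _) ⟨hA.1.image _, hA.2.image_val⟩
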